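/- For a graph $G$ on $n$ vertices let $S(G)$ be the set of all real symmetric $n\times n$ matrices $A=(a_{ij})$, with rows and columns indexed by the vertices, such that for all $i\ne j$ one has $a_{ij}\neq 0$ if and only if $ij$ is an edge of $G$ (the diagonal entries are unrestricted). Let $q(A)$ be the number of distinct eigenvalues of $A$ and $q(G)=\min\{q(A): A\in S(G)\}$. A binary sequence $(b_1,\dots,b_n)$ is a creation sequence of the graph obtained by adding vertices $v_1,\dots,v_n$ one at a time, where $v_i$ is added as an isolated vertex if $b_i=0$ and as a vertex adjacent to all previous vertices if $b_i=1$; the graphs isomorphic to graphs arising in this way are the threshold graphs. There are exactly 32 connected threshold graphs on 7 vertices up to isomorphism; they are the graphs with the following creation sequences (which are pairwise non-isomorphic), and their values of $q$ are as follows. $q(G)=4$ for exactly one graph: $G\cong (0,0,0,1,0,0,1)$. $q(G)=3$ for exactly the following 21 graphs: $(0,0,0,0,0,0,1),\ (0,1,0,0,0,0,1),\ (0,0,1,0,0,0,1),\ (0,0,0,0,1,0,1),\ (0,0,0,0,0,1,1),\ (0,1,1,0,0,0,1),\ (0,1,0,1,0,0,1),\ (0,1,0,0,1,0,1),\ (0,1,0,0,0,1,1),\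 (0,0,1,1,0,0,1),\ (0,0,1,0,1,0,1),\ (0,0,1,0,0,1,1),\ (0,0,0,1,1,0,1),\ (0,0,0,1,0,1,1),\ (0,0,0,0,1,1,1),\ (0,1,1,1,0,0,1),\ (0,1,1,0,1,0,1),\ (0,1,1,0,0,1,1),\ (0,1,0,1,1,0,1),\ (0,0,1,1,1,0,1),\ (0,1,1,1,1,0,1)$. $q(G)=2$ for exactly the following 10 graphs: $(0,1,0,1,0,1,1),\ (0,1,0,0,1,1,1),\ (0,0,1,1,0,1,1),\ (0,0,1,0,1,1,1),\ (0,0,0,1,1,1,1),\ (0,1,0,1,1,1,1),\ (0,1,1,0,1,1,1),\ (0,1,1,1,0,1,1),\ (0,1,1,1,1,1,1),\ (0,0,1,1,1,1,1)$. -/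

import Mathlib

universe u

/-- `S(G)`: the real symmetric matrices whose off-diagonal entry at `(i, j)` is nonzero exactly
when `i` and `j` are adjacent; the diagonal is unrestricted. -/
def graphMatrices {V : Type u} (G : SimpleGraph V) : Set (Matrix V V ℝ) :=
  {A | A.IsSymm ∧ ∀ i j, i ≠ j → (A i j ≠ 0 ↔ G.Adj i j)}

theorem graphMatrices_nonempty {V : Type u} (G : SimpleGraph V) : (graphMatrices G).Nonempty := by
  classical
  exact ⟨G.adjMatrix ℝ, G.isSymm_adjMatrix, fun i j _ => by simp [SimpleGraph.adjMatrix_apply]⟩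

/-- `q(A)`: the number of distinct (real) eigenvalues of `A`. -/
noncomputable def numDistinctEigenvalues {V : Type u} [Fintype V] (A : Matrix V V ℝ) : ℕ :=
  {μ : ℝ | Module.End.HasEigenvalue A.mulVecLin μ}.ncard

/-- `q(G)`: the minimum of `q(A)` over `A ∈ S(G)`. The infimum is over a nonempty set of natural
numbers, so it is attained. -/
noncomputable def minDistinctEigenvalues {V : Type u} [Fintype V] (G : SimpleGraph V) : ℕ :=
  sInf (numDistinctEigenvalues '' graphMatrices G)

/-- The threshold graph with creation sequence `b`. The vertices are added in the order
`0, 1, …, n - 1`; vertex `i` is added isolated if `b i = 0`, and adjacent to all previous vertices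
if `b i = 1`. So two distinct vertices are adjacent exactly when the later one has label `1`. -/
def creationGraph {n : ℕ} (b : Fin n → Fin 2) : SimpleGraph (Fin n) where
  Adj i j := i ≠ j ∧ b (max i j) = 1
  symm := ⟨fun i j h => ⟨h.1.symm, by rw [max_comm]; exact h.2⟩⟩
  loopless := ⟨fun _ h => h.1 rfl⟩

/-- `G ≅ (b 0, …, b (n - 1))`. -/
def HasCreationSequence {V : Type u} (G : SimpleGraph V) {n : ℕ} (b : Fin n → Fin 2) : Prop :=
  Nonempty (G ≃g creationGraph b)

/-- A finite threshold graph: one that arises from some creation sequence. -/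
def IsThresholdGraph {V : Type u} [Fintype V] (G : SimpleGraph V) : Prop :=
  ∃ b : Fin (Fintype.card V) → Fin 2, HasCreationSequence G b

/-- Creation sequences of the connected threshold graphs on seven vertices, each with the
corresponding value of `q`. -/
def orderSevenTable : List ((Fin 7 → Fin 2) × ℕ) :=
  [ (![0, 0, 0, 0, 0, 0, 1], 3),
    (![0, 1, 0, 0, 0, 0, 1], 3),
    (![0, 0, 1, 0, 0, 0, 1], 3),
    (![0, 0, 0, 1, 0, 0, 1], 4),
    (![0, 0, 0, 0, 1, 0, 1], 3),
    (![0, 0, 0, 0, 0, 1, 1], 3),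
    (![0, 1, 1, 0, 0, 0, 1], 3),
    (![0, 1, 0, 1, 0, 0, 1], 3),
    (![0, 1, 0, 0, 1, 0, 1], 3),
    (![0, 1, 0, 0, 0, 1, 1], 3),
    (![0, 0, 1, 1, 0, 0, 1], 3),
    (![0, 0, 1, 0, 1, 0, 1], 3),
    (![0, 0, 1, 0, 0, 1, 1], 3),
    (![0, 0, 0, 1, 1, 0, 1], 3),
    (![0, 0, 0, 1, 0, 1, 1], 3),
    (![0, 0, 0, 0, 1, 1, 1], 3),
    (![0, 1, 1, 1, 0, 0, 1], 3),
    (![0, 1, 1, 0, 1, 0, 1], 3),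
    (![0, 1, 1, 0, 0, 1, 1], 3),
    (![0, 1, 0, 1, 1, 0, 1], 3),
    (![0, 1, 0, 1, 0, 1, 1], 2),
    (![0, 1, 0, 0, 1, 1, 1], 2),
    (![0, 0, 1, 1, 1, 0, 1], 3),
    (![0, 0, 1, 1, 0, 1, 1], 2),
    (![0, 0, 1, 0, 1, 1, 1], 2),
    (![0, 0, 0, 1, 1, 1, 1], 2),
    (![0, 1, 0, 1, 1, 1, 1], 2),
    (![0, 1, 1, 0, 1, 1, 1], 2),
    (![0, 1, 1, 1, 0, 1, 1], 2),
    (![0, 1, 1, 1, 1, 0, 1], 3),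
    (![0, 1, 1, 1, 1, 1, 1], 2),
    (![0, 0, 1, 1, 1, 1, 1], 2) ]

/-! ### Eigenvalue counts and annihilating polynomials. -/

section Spectrum

open Matrix Polynomial

variable {V : Type*} [Fintype V]

/-! A real symmetric matrix has at most `k` eigenvalues exactly when a product of `k` real linear
factors annihilates it, so each bound on `q` becomes a statement about matrix entries.

Upper bounds come from explicit integer data: a symmetric `M` with the right pattern and positive
weights `W`. The matrix `√W M √W` lies in `S(G)` and is similar to `W M`, whose annihilating
polynomial is checked in integer arithmetic (`IsEigenvalueCertificate.minDistinctEigenvalues_le`).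

Lower bounds: an edge excludes one eigenvalue. Two eigenvalues make `A²` a combination of `A` and
`1`, so nonadjacent vertices have orthogonal rows; an independent set whose shared neighbours are
too few excludes this (`three_le_minDistinctEigenvalues`). For `(0,0,0,1,0,0,1)`, entries of a cubic
relation force one coefficient to be both positive and negative (`cubic_ne_zero_of_pendant`).

The first label never matters and connectedness fixes the last, which leaves `2 ^ 5 = 32` sequences;
degrees distinguish them. -/

theorem finite_setOf_hasEigenvalue (A : Matrix V V ℝ) :
    {μ : ℝ | Module.End.HasEigenvalue A.mulVecLin μ}.Finite :=
  Module.End.finite_hasEigenvalue A.mulVecLin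

theorem hasEigenvalue_mulVecLin_iff {A : Matrix V V ℝ} {μ : ℝ} :
    Module.End.HasEigenvalue A.mulVecLin μ ↔ ∃ v : V → ℝ, v ≠ 0 ∧ A *ᵥ v = μ • v := by
  constructor
  · intro h
    obtain ⟨v, hv⟩ := h.exists_hasEigenvector
    exact ⟨v, hv.2, hv.apply_eq_smul⟩
  · rintro ⟨v, hv, h⟩
    exact Module.End.hasEigenvalue_of_hasEigenvector
      (Module.End.hasEigenvector_iff.2 ⟨Module.End.mem_eigenspace_iff.2 h, hv⟩)

theorem list_prod_sub_smul_mulVec [DecidableEq V] {A : Matrix V V ℝ} {μ : ℝ} {v : V → ℝ}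
    (h : A *ᵥ v = μ • v) (l : List ℝ) :
    (l.map fun r => A - r • (1 : Matrix V V ℝ)).prod *ᵥ v = (l.map fun r => μ - r).prod • v := by
  induction l with
  | nil => simp
  | cons r l ih =>
    rw [List.map_cons, List.prod_cons, ← mulVec_mulVec, ih, mulVec_smul, sub_mulVec, h,
      smul_mulVec, one_mulVec, ← sub_smul, smul_smul, List.map_cons, List.prod_cons, mul_comm]

/-- A matrix annihilated by a product of `k` linear factors has at most `k` eigenvalues. -/
theorem numDistinctEigenvalues_le_length [DecidableEq V] {A : Matrix V V ℝ} (l : List ℝ)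
    (h : (l.map fun r => A - r • (1 : Matrix V V ℝ)).prod = 0) :
    numDistinctEigenvalues A ≤ l.length := by
  have hsub : {μ : ℝ | Module.End.HasEigenvalue A.mulVecLin μ} ⊆ (l.toFinset : Set ℝ) := by
    intro μ hμ
    obtain ⟨v, hv, hAv⟩ := hasEigenvalue_mulVecLin_iff.1 hμ
    have h0 := list_prod_sub_smul_mulVec hAv l
    rw [h, zero_mulVec, eq_comm, smul_eq_zero, or_iff_left hv, List.prod_eq_zero_iff,
      List.mem_map] at h0
    obtain ⟨r, hr, hr0⟩ := h0
    rw [sub_eq_zero] at hr0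
    simpa [hr0] using hr
  calc numDistinctEigenvalues A ≤ (l.toFinset : Set ℝ).ncard :=
        Set.ncard_le_ncard hsub (Finset.finite_toSet _)
    _ = l.toFinset.card := Set.ncard_coe_finset _
    _ ≤ l.length := l.toFinset_card_le

theorem numDistinctEigenvalues_submatrix {W : Type*} [Fintype W] (A : Matrix V V ℝ) (e : W ≃ V) :
    numDistinctEigenvalues (A.submatrix e e) = numDistinctEigenvalues A := by
  unfold numDistinctEigenvalues
  congr 1
  ext μ
  simp only [Set.mem_ofPred_eq, hasEigenvalue_mulVecLin_iff]
  constructor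
  · rintro ⟨v, hv, h⟩
    refine ⟨v ∘ e.symm, fun h0 => hv ?_, ?_⟩
    · ext i; simpa using congrFun h0 (e i)
    · rw [submatrix_mulVec_equiv] at h
      ext i; simpa [Function.comp_assoc] using congrFun h (e.symm i)
  · rintro ⟨v, hv, h⟩
    refine ⟨v ∘ e, fun h0 => hv ?_, ?_⟩
    · ext i; simpa using congrFun h0 (e.symm i)
    · have hve : (v ∘ e) ∘ e.symm = v := by ext i; simp
      rw [submatrix_mulVec_equiv, hve, h]
      rfl

/-- The symmetric matrix `√W M √W` has only eigenvalues of `W M`. -/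
theorem numDistinctEigenvalues_sqrt_le [DecidableEq V] (M : Matrix V V ℝ) (w : V → ℝ)
    (hw : ∀ i, 0 < w i) :
    numDistinctEigenvalues (of fun i j => √(w i) * M i j * √(w j)) ≤
      numDistinctEigenvalues (diagonal w * M) := by
  refine Set.ncard_le_ncard (fun μ hμ => ?_) (finite_setOf_hasEigenvalue _)
  simp only [Set.mem_ofPred_eq, hasEigenvalue_mulVecLin_iff] at hμ ⊢
  obtain ⟨v, hv, h⟩ := hμ
  -- `W M (√W v) = √W (√W M √W) v`, so `√W v` is an eigenvector for the same eigenvalue.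
  refine ⟨fun i => √(w i) * v i, fun h0 => hv ?_, ?_⟩
  · ext i
    have := congrFun h0 i
    simpa [(Real.sqrt_pos.2 (hw i)).ne'] using this
  · ext i
    have hi := congrFun h i
    simp only [mulVec, dotProduct, of_apply, Pi.smul_apply, smul_eq_mul] at hi
    rw [← mulVec_mulVec, mulVec_diagonal]
    simp only [mulVec, dotProduct, Pi.smul_apply, smul_eq_mul]
    calc w i * ∑ j, M i j * (√(w j) * v j)
        = √(w i) * ∑ j, √(w i) * M i j * √(w j) * v j := by
          nth_rewrite 1 [← Real.mul_self_sqrt (hw i).le]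
          rw [mul_assoc, Finset.mul_sum]
          congr 1
          exact Finset.sum_congr rfl fun j _ => by ring
      _ = μ * (√(w i) * v i) := by rw [hi]; ring

/-- A real symmetric matrix with at most `k ≤ |V|` eigenvalues is annihilated by a monic polynomial
with `k` distinct real roots. -/
theorem exists_aeval_prod_eq_zero [DecidableEq V] {A : Matrix V V ℝ} (hA : A.IsSymm) {k : ℕ}
    (hk : numDistinctEigenvalues A ≤ k) :
    ∃ s : Finset ℝ, s.card = k ∧ aeval A (∏ r ∈ s, (X - C r)) = 0 := by
  -- The spectrum is padded with arbitrary reals to exactly `k` roots, which spares later proofs a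
  -- case split on the number of eigenvalues.
  obtain ⟨s, hs, hcard⟩ := Infinite.exists_superset_card_eq (finite_setOf_hasEigenvalue A).toFinset k
    (by rwa [← Set.ncard_eq_toFinset_card _ (finite_setOf_hasEigenvalue A)])
  refine ⟨s, hcard, ?_⟩
  have hH : A.IsHermitian := by
    rw [IsHermitian, conjTranspose_eq_transpose_of_trivial, hA.eq]
  have hev (i : V) : hH.eigenvalues i ∈ s := by
    apply hs
    rw [Set.Finite.mem_toFinset]
    refine hasEigenvalue_mulVecLin_iff.2 ⟨_, ?_, hH.mulVec_eigenvectorBasis i⟩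
    intro h0
    exact hH.eigenvectorBasis.orthonormal.ne_zero i (by ext j; simpa using congrFun h0 j)
  have hdiag : aeval (diagonal hH.eigenvalues) (∏ r ∈ s, (X - C r)) = 0 := by
    have := aeval_algHom_apply (diagonalAlgHom (n := V) (α := ℝ) ℝ) hH.eigenvalues
      (∏ r ∈ s, (X - C r))
    rw [diagonalAlgHom_apply] at this
    rw [this, diagonalAlgHom_apply, diagonal_eq_zero]
    ext i
    rw [aeval_pi_apply₂, Pi.zero_apply, coe_aeval_eq_eval, eval_prod]
    exact Finset.prod_eq_zero (hev i) (by simp)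
  have hspec := hH.spectral_theorem
  have hcomp : ((RCLike.ofReal : ℝ → ℝ) ∘ hH.eigenvalues) = hH.eigenvalues := by ext; simp
  rw [hcomp] at hspec
  rw [hspec, aeval_algHom_apply, hdiag, map_zero]

end Spectrum

/-! ### General lower bounds and isomorphism invariance of `q`. -/

section MinDistinctEigenvalues

open Matrix Polynomial

variable {V : Type*} [Fintype V] {G : SimpleGraph V}

theorem minDistinctEigenvalues_le {A : Matrix V V ℝ} (hA : A ∈ graphMatrices G) :
    minDistinctEigenvalues G ≤ numDistinctEigenvalues A :=
  Nat.sInf_le ⟨A, hA, rfl⟩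

/-- Nonemptiness of `S(G)` is essential: `sInf ∅ = 0` in `ℕ`. -/
theorem le_minDistinctEigenvalues {k : ℕ}
    (h : ∀ A ∈ graphMatrices G, k ≤ numDistinctEigenvalues A) : k ≤ minDistinctEigenvalues G := by
  refine le_csInf ((graphMatrices_nonempty G).image _) ?_
  rintro _ ⟨A, hA, rfl⟩
  exact h A hA

theorem SimpleGraph.Iso.minDistinctEigenvalues_le {W : Type*} [Fintype W] {H : SimpleGraph W}
    (e : G ≃g H) : minDistinctEigenvalues G ≤ minDistinctEigenvalues H := by
  refine le_minDistinctEigenvalues fun A hA => ?_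
  rw [← numDistinctEigenvalues_submatrix A e.toEquiv]
  refine _root_.minDistinctEigenvalues_le ⟨hA.1.submatrix _, fun i j hij => ?_⟩
  exact (hA.2 (e i) (e j) (e.injective.ne hij)).trans e.map_adj_iff

theorem SimpleGraph.Iso.minDistinctEigenvalues_eq {W : Type*} [Fintype W] {H : SimpleGraph W}
    (e : G ≃g H) : minDistinctEigenvalues G = minDistinctEigenvalues H :=
  le_antisymm e.minDistinctEigenvalues_le e.symm.minDistinctEigenvalues_le

/-- A symmetric matrix with a single eigenvalue is scalar, so it vanishes at the edge. -/
theorem two_le_minDistinctEigenvalues {u v : V} (h : G.Adj u v) : 2 ≤ minDistinctEigenvalues G := by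
  classical
  refine le_minDistinctEigenvalues fun A hA => ?_
  by_contra! hlt
  obtain ⟨s, hs, h0⟩ := exists_aeval_prod_eq_zero hA.1 (Nat.le_of_lt_succ hlt)
  obtain ⟨r, rfl⟩ := Finset.card_eq_one.1 hs
  have := congrFun (congrFun h0 u) v
  simp only [Finset.prod_singleton, map_sub, aeval_X, aeval_C, Algebra.algebraMap_eq_smul_one,
    Matrix.sub_apply, Matrix.smul_apply, one_apply_ne h.ne, smul_zero, sub_zero, Matrix.zero_apply] at this
  exact (hA.2 u v h.ne).2 h this

/-- If the vertices of `S` are pairwise nonadjacent, have neighbours in a smaller set `T`, and share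
no neighbours outside `T`, then no matrix of `G` has two eigenvalues only: otherwise the rows indexed
by `S`, restricted to `T`, would be orthogonal. -/
theorem three_le_minDistinctEigenvalues (S T : Finset V) (hcard : T.card < S.card)
    (hS : ∀ i ∈ S, ∀ j ∈ S, ¬ G.Adj i j)
    (hT : ∀ i ∈ S, ∀ j ∈ S, i ≠ j → ∀ k, G.Adj i k → G.Adj j k → k ∈ T)
    (hne : ∀ i ∈ S, ∃ k ∈ T, G.Adj i k) : 3 ≤ minDistinctEigenvalues G := by
  classical
  refine le_minDistinctEigenvalues fun A hA => ?_
  by_contra! hlt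
  obtain ⟨s, hs, h0⟩ := exists_aeval_prod_eq_zero hA.1 (Nat.le_of_lt_succ hlt)
  obtain ⟨a, b, hab, rfl⟩ := Finset.card_eq_two.1 hs
  have hzero (i : V) (hi : i ∈ S) (j : V) (hij : i ≠ j) (hadj : ¬ G.Adj i j) : A i j = 0 := by
    by_contra h
    exact hadj ((hA.2 i j hij).1 h)
  have horth (i : V) (hi : i ∈ S) (j : V) (hj : j ∈ S) (hij : i ≠ j) :
      ∑ k ∈ T, A i k * A j k = 0 := by
    have hAij := hzero i hi j hij (hS i hi j hj)
    -- `A²` is a linear combination of `A` and `1`, both zero at `(i, j)`.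
    have h1 : (A * A) i j = 0 := by
      have h2 := congrFun (congrFun h0 i) j
      rw [Finset.prod_pair hab] at h2
      simp only [map_mul, map_sub, aeval_X, aeval_C, Algebra.algebraMap_eq_smul_one, sub_mul,
        mul_sub, smul_mul, one_mul, Matrix.mul_smul, mul_one, Matrix.sub_apply, Matrix.smul_apply, hAij,
        one_apply_ne hij, smul_zero, sub_zero, Matrix.zero_apply] at h2
      exact h2
    rw [mul_apply] at h1
    rw [← h1]
    have hsym (k : V) : A k j = A j k := hA.1.apply j k
    simp only [hsym]
    refine Finset.sum_subset (Finset.subset_univ T) fun k _ hk => ?_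
    -- Diagonal entries may be nonzero, but the terms `k = i` and `k = j` contain the factor `A i j
    -- = 0`. Any other nonzero term comes from a common neighbour, hence from `T`.
    by_contra hne0
    obtain ⟨hi0, hj0⟩ := mul_ne_zero_iff.1 hne0
    rcases eq_or_ne i k with rfl | hik
    · exact hj0 (by rw [← hsym, hAij])
    rcases eq_or_ne j k with rfl | hjk
    · exact hi0 hAij
    exact hk (hT i hi j hj hij k ((hA.2 i k hik).1 hi0) ((hA.2 j k hjk).1 hj0))
  let v : S → EuclideanSpace ℝ T := fun i => WithLp.toLp 2 fun k => A i k
  -- Nonzero pairwise orthogonal vectors in `ℝ^T` number at most `|T|`.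
  have hind : LinearIndependent ℝ v := by
    refine linearIndependent_of_ne_zero_of_inner_eq_zero (𝕜 := ℝ) (fun i h => ?_) fun i j hij => ?_
    · obtain ⟨k, hk, hadj⟩ := hne i i.2
      refine (hA.2 i k hadj.ne).2 hadj ?_
      simpa [v] using congrArg (fun x : EuclideanSpace ℝ T => x ⟨k, hk⟩) h
    · have := horth i i.2 j j.2 (Subtype.coe_injective.ne hij)
      rw [← Finset.sum_coe_sort T] at this
      simpa [v, PiLp.inner_apply, mul_comm] using this
  have := hind.fintype_card_le_finrank
  simp at this
  omega

end MinDistinctEigenvalues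

/-! ### The exceptional graph with `q = 4`. -/

section Cubic

open Matrix Polynomial

/-- Passing to elementary symmetric functions lets the roots be replaced by three coefficients `s`,
`t`, `u`. -/
theorem cubic_entry {n : Type*} [Fintype n] [DecidableEq n] {B : Matrix n n ℝ} {a b c : ℝ}
    (h : (B - a • 1) * (B - b • 1) * (B - c • 1) = 0) (i j : n) :
    (B * B * B) i j - (a + b + c) * (B * B) i j + (a * b + b * c + c * a) * B i j
      - a * b * c * (1 : Matrix n n ℝ) i j = 0 := by
  have h1 : B * B * B - (a + b + c) • (B * B) + (a * b + b * c + c * a) • B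
      - (a * b * c) • (1 : Matrix n n ℝ) = 0 := by
    rw [← h]
    simp only [sub_mul, mul_sub, smul_mul, Matrix.mul_smul, one_mul, mul_one, smul_smul, add_smul]
    simp only [mul_comm, mul_left_comm, mul_assoc]
    abel
  have := congrFun (congrFun h1 i) j
  simpa only [Matrix.sub_apply, Matrix.add_apply, Matrix.smul_apply, smul_eq_mul, Matrix.zero_apply] using this

/-- The graph with creation sequence `(0, 0, 0, 1, 0, 0, 1)` has no matrix annihilated by a cubic
with real roots, if the diagonal entry at one of the two pendant vertices is `0`. -/
theorem cubic_ne_zero_of_pendant {B : Matrix (Fin 7) (Fin 7) ℝ}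
    (hB : B ∈ graphMatrices (creationGraph ![0, 0, 0, 1, 0, 0, 1])) (h44 : B 4 4 = 0) (a b c : ℝ) :
    (B - a • 1) * (B - b • 1) * (B - c • 1) ≠ 0 := by
  intro h
  have H := cubic_entry h
  generalize a + b + c = s at H
  generalize a * b + b * c + c * a = t at H
  generalize a * b * c = u at H
  have hz (i j : Fin 7) (hij : i ≠ j)
      (hb : (![0, 0, 0, 1, 0, 0, 1] : Fin 7 → Fin 2) (max i j) = 0) : B i j = 0 := by
    by_contra h0
    have := ((hB.2 i j hij).1 h0).2
    rw [hb] at this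
    exact absurd this (by decide)
  have hnz (i j : Fin 7) (hij : i ≠ j)
      (hb : (![0, 0, 0, 1, 0, 0, 1] : Fin 7 → Fin 2) (max i j) = 1) : B i j ≠ 0 :=
    (hB.2 i j hij).2 ⟨hij, hb⟩
  have hs (i j : Fin 7) : B i j = B j i := hB.1.apply j i
  have z01 : B 0 1 = 0 := hz 0 1 (by decide) (by decide)
  have z02 : B 0 2 = 0 := hz 0 2 (by decide) (by decide)
  have z12 : B 1 2 = 0 := hz 1 2 (by decide) (by decide)
  have z04 : B 0 4 = 0 := hz 0 4 (by decide) (by decide)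
  have z14 : B 1 4 = 0 := hz 1 4 (by decide) (by decide)
  have z24 : B 2 4 = 0 := hz 2 4 (by decide) (by decide)
  have z34 : B 3 4 = 0 := hz 3 4 (by decide) (by decide)
  have z05 : B 0 5 = 0 := hz 0 5 (by decide) (by decide)
  have z15 : B 1 5 = 0 := hz 1 5 (by decide) (by decide)
  have z25 : B 2 5 = 0 := hz 2 5 (by decide) (by decide)
  have z35 : B 3 5 = 0 := hz 3 5 (by decide) (by decide)
  have z45 : B 4 5 = 0 := hz 4 5 (by decide) (by decide)
  have n03 : B 0 3 ≠ 0 := hnz 0 3 (by decide) (by decide)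
  have n13 : B 1 3 ≠ 0 := hnz 1 3 (by decide) (by decide)
  have n23 : B 2 3 ≠ 0 := hnz 2 3 (by decide) (by decide)
  have n06 : B 0 6 ≠ 0 := hnz 0 6 (by decide) (by decide)
  have n16 : B 1 6 ≠ 0 := hnz 1 6 (by decide) (by decide)
  have n26 : B 2 6 ≠ 0 := hnz 2 6 (by decide) (by decide)
  have n36 : B 3 6 ≠ 0 := hnz 3 6 (by decide) (by decide)
  have n46 : B 4 6 ≠ 0 := hnz 4 6 (by decide) (by decide)
  have n56 : B 5 6 ≠ 0 := hnz 5 6 (by decide) (by decide)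
  have e40 := H 4 0
  have e41 := H 4 1
  have e42 := H 4 2
  have e43 := H 4 3
  have e44 := H 4 4
  have e45 := H 4 5
  have e46 := H 4 6
  have e50 := H 5 0
  have e01 := H 0 1
  have e02 := H 0 2
  have e12 := H 1 2
  have e00 := H 0 0
  simp only [mul_apply, Fin.sum_univ_seven, hs 1 0, hs 2 0, hs 2 1, hs 3 0, hs 3 1, hs 3 2, hs 4 0,
    hs 4 1, hs 4 2, hs 4 3, hs 5 0, hs 5 1, hs 5 2, hs 5 3, hs 5 4, hs 6 0, hs 6 1, hs 6 2, hs 6 3,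
    hs 6 4, hs 6 5, z01, z02, z12, z04, z14, z24, z34, z05, z15, z25, z35, z45, h44, mul_zero,
    zero_mul, add_zero, zero_add, one_apply_eq, one_apply_ne (show (4 : Fin 7) ≠ 0 by decide),
    one_apply_ne (show (4 : Fin 7) ≠ 1 by decide), one_apply_ne (show (4 : Fin 7) ≠ 2 by decide),
    one_apply_ne (show (4 : Fin 7) ≠ 3 by decide), one_apply_ne (show (4 : Fin 7) ≠ 5 by decide),
    one_apply_ne (show (4 : Fin 7) ≠ 6 by decide), one_apply_ne (show (5 : Fin 7) ≠ 0 by decide),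
    one_apply_ne (show (0 : Fin 7) ≠ 1 by decide), one_apply_ne (show (0 : Fin 7) ≠ 2 by decide),
    one_apply_ne (show (1 : Fin 7) ≠ 2 by decide), mul_one, sub_zero]
    at e40 e41 e42 e43 e44 e45 e46 e50 e01 e02 e12 e00
  clear H hz hnz hs z01 z02 z12 z04 z14 z24 z34 z05 z15 z25 z35 z45 h h44 hB
  -- Vertices 0, 1, 2 have neighbours 3 and 6 (weights `xᵢ`, `yᵢ`); vertices 4 and 5 are pendant at
  -- 6 (weights `z₅`, `z₆`). Subscripts count vertices from 1.
  generalize B 0 0 = d₁ at *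
  generalize B 1 1 = d₂ at *
  generalize B 2 2 = d₃ at *
  generalize B 0 3 = x₁ at *
  generalize B 1 3 = x₂ at *
  generalize B 2 3 = x₃ at *
  generalize B 0 6 = y₁ at *
  generalize B 1 6 = y₂ at *
  generalize B 2 6 = y₃ at *
  generalize B 3 3 = e at *
  generalize B 3 6 = f at *
  generalize B 6 6 = g at *
  generalize B 5 5 = d₆ at *
  generalize B 4 6 = z₅ at *
  generalize B 5 6 = z₆ at *
  have k1 : y₁ * (g + d₁ - s) + f * x₁ = 0 := mul_left_cancel₀ n46 (by linear_combination e40)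
  have k6 : y₁ * (d₆ + g + d₁ - s) + f * x₁ = 0 := mul_left_cancel₀ n56 (by linear_combination e50)
  -- The rows of the two pendant vertices give the same relation up to `d₆ * y₁`.
  have hd₆ : d₆ = 0 := mul_left_cancel₀ n06 (by linear_combination k6 - k1)
  subst hd₆
  have hgs : s = g :=
    mul_left_cancel₀ (mul_ne_zero n46 n56) (by linear_combination -e45)
  subst hgs
  have k1 : y₁ * d₁ + f * x₁ = 0 := by linear_combination k1
  have k2 : y₂ * d₂ + f * x₂ = 0 := mul_left_cancel₀ n46 (by linear_combination e41)
  have k3 : y₃ * d₃ + f * x₃ = 0 := mul_left_cancel₀ n46 (by linear_combination e42)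
  have k4 : f * e + (x₁ * y₁ + x₂ * y₂ + x₃ * y₃) = 0 :=
    mul_left_cancel₀ n46 (by linear_combination e43)
  have ht : t = -(y₁ ^ 2 + y₂ ^ 2 + y₃ ^ 2 + f ^ 2 + z₅ ^ 2 + z₆ ^ 2) :=
    mul_left_cancel₀ n46 (by linear_combination e46)
  have hu : u = 0 := by linear_combination -e44
  have c12 : d₁ + d₂ - s + e = 0 :=
    mul_left_cancel₀ (mul_ne_zero n03 n13)
      (by linear_combination e01 - y₂ * k1 - y₁ * k2)
  have c13 : d₁ + d₃ - s + e = 0 :=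
    mul_left_cancel₀ (mul_ne_zero n03 n23) (by linear_combination e02 - y₃ * k1 - y₁ * k3)
  have c23 : d₂ + d₃ - s + e = 0 :=
    mul_left_cancel₀ (mul_ne_zero n13 n23) (by linear_combination e12 - y₃ * k2 - y₂ * k3)
  have hd2 : d₂ = d₁ := by linear_combination c23 - c13
  have hd3 : d₃ = d₁ := by linear_combination c23 - c12
  -- The common diagonal value at vertices 0, 1, 2 survives under the name `d₃`.
  subst hd2 hd3
  have hd0 : d₃ ≠ 0 := by
    rintro rfl
    exact mul_ne_zero n36 n03 (by linear_combination k1)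
  have he : f ^ 2 * e = d₃ * (y₁ ^ 2 + y₂ ^ 2 + y₃ ^ 2) := by
    linear_combination f * k4 - y₁ * k1 - y₂ * k2 - y₃ * k3
  have hs : s = e + 2 * d₃ := by linear_combination -c12
  have ht2 : t = d₃ ^ 2 + d₃ * e := by
    refine mul_left_cancel₀ hd0 ?_
    subst hs
    linear_combination e00 - 2 * y₁ * k1 + hu
  have ht3 : f ^ 2 * t = d₃ ^ 2 * (f ^ 2 + (y₁ ^ 2 + y₂ ^ 2 + y₃ ^ 2)) := by
    rw [ht2]; linear_combination d₃ * he
  -- Here `t` is positive, whereas `ht` makes it minus a sum of squares.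
  have hpos : 0 < f ^ 2 * t := by rw [ht3]; positivity
  have hneg : f ^ 2 * t < 0 := by
    rw [ht]
    exact mul_neg_of_pos_of_neg (by positivity) (neg_lt_zero.2 (by positivity))
  exact lt_asymm hpos hneg

theorem four_le_minDistinctEigenvalues :
    4 ≤ minDistinctEigenvalues (creationGraph ![0, 0, 0, 1, 0, 0, 1]) := by
  refine le_minDistinctEigenvalues fun A hA => ?_
  by_contra! hlt
  obtain ⟨s, hs, h0⟩ := exists_aeval_prod_eq_zero hA.1 (Nat.le_of_lt_succ hlt)
  obtain ⟨a, b, c, hab, hac, hbc, rfl⟩ := Finset.card_eq_three.1 hs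
  rw [Finset.prod_insert (by simp [hab, hac]), Finset.prod_pair hbc, ← mul_assoc] at h0
  simp only [map_mul, map_sub, aeval_X, aeval_C, Algebra.algebraMap_eq_smul_one] at h0
  -- A scalar shift preserves the pattern and translates the roots, so the entry at `(4, 4)` may be
  -- taken to be zero.
  have hB : A - A 4 4 • (1 : Matrix (Fin 7) (Fin 7) ℝ) ∈
      graphMatrices (creationGraph ![0, 0, 0, 1, 0, 0, 1]) := by
    refine ⟨hA.1.sub (isSymm_one.smul _), fun i j hij => ?_⟩
    rw [← hA.2 i j hij, Matrix.sub_apply, Matrix.smul_apply, one_apply_ne hij, smul_zero, sub_zero]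
  have hshift (r : ℝ) : A - A 4 4 • (1 : Matrix (Fin 7) (Fin 7) ℝ) - (r - A 4 4) • 1 = A - r • 1 := by
    rw [sub_smul, sub_sub, add_sub_cancel]
  refine cubic_ne_zero_of_pendant hB (by simp) (a - A 4 4) (b - A 4 4) (c - A 4 4) ?_
  rw [hshift, hshift, hshift, h0]

end Cubic

/-! ### Upper bounds by integer certificates. -/

section Certificates

open Matrix Polynomial

/-- `M` has the pattern of `creationGraph b`, and `diagonal w * M`, with `w` positive, is annihilated
by the polynomial with the `k` roots `l`. -/
def IsEigenvalueCertificate {n : ℕ} (b : Fin n → Fin 2) (k : ℕ)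
    (c : (Fin n → ℤ) × (Fin n → Fin n → ℤ) × List ℤ) : Prop :=
  (∀ i j, c.2.1 i j = c.2.1 j i) ∧ (∀ i j, i ≠ j → (c.2.1 i j ≠ 0 ↔ b (max i j) = 1)) ∧
    (∀ i, 0 < c.1 i) ∧ c.2.2.length = k ∧
    ∀ i j, of.symm (c.2.2.map fun r => (of fun i j => c.1 i * c.2.1 i j - if i = j then r else 0 :
      Matrix (Fin n) (Fin n) ℤ)).prod i j = 0

instance {n : ℕ} (b : Fin n → Fin 2) (k : ℕ)
    (c : (Fin n → ℤ) × (Fin n → Fin n → ℤ) × List ℤ) :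
    Decidable (IsEigenvalueCertificate b k c) := by
  unfold IsEigenvalueCertificate; infer_instance

/-- The member of `S(G)` is `√W M √W`, usually irrational; the similar matrix `W M` is integral,
which makes the check decidable. -/
theorem IsEigenvalueCertificate.minDistinctEigenvalues_le {n : ℕ} {b : Fin n → Fin 2} {k : ℕ}
    {c : (Fin n → ℤ) × (Fin n → Fin n → ℤ) × List ℤ} (h : IsEigenvalueCertificate b k c) :
    minDistinctEigenvalues (creationGraph b) ≤ k := by
  obtain ⟨w, M, l⟩ := c
  obtain ⟨hsymm, hpat, hw, hl, hprod⟩ := h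
  dsimp only at *
  have hw' (i : Fin n) : 0 < (w i : ℝ) := Int.cast_pos.2 (hw i)
  have hs (i : Fin n) : √(w i : ℝ) ≠ 0 := (Real.sqrt_pos.2 (hw' i)).ne'
  have hmem : (of fun i j => √(w i : ℝ) * ((of M).map (Int.castRingHom ℝ)) i j * √(w j : ℝ)) ∈
      graphMatrices (creationGraph b) := by
    refine ⟨IsSymm.ext fun i j => ?_, fun i j hij => ?_⟩
    · simp only [of_apply, Matrix.map_apply, hsymm j i]; ring
    · rw [of_apply, mul_ne_zero_iff, mul_ne_zero_iff, and_iff_left (hs j), and_iff_right (hs i),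
        Matrix.map_apply, eq_intCast, Int.cast_ne_zero, of_apply, hpat i j hij]
      exact (and_iff_right hij).symm
  refine (_root_.minDistinctEigenvalues_le hmem).trans
    ((numDistinctEigenvalues_sqrt_le _ _ hw').trans ?_)
  rw [← hl, ← List.length_map (as := l) (Int.cast : ℤ → ℝ)]
  refine numDistinctEigenvalues_le_length _ ?_
  have h0 : (l.map fun r => (of fun i j => w i * M i j - if i = j then r else 0 :
      Matrix (Fin n) (Fin n) ℤ)).prod = 0 := by
    ext i j; exact hprod i j
  have h1 := congrArg (Int.castRingHom ℝ).mapMatrix h0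
  rw [map_list_prod, map_zero, List.map_map] at h1
  rw [List.map_map, ← h1]
  congr 2
  ext r i j
  simp [diagonal_mul, one_apply]

/-- Certificates for the upper bounds in `orderSevenTable`. -/
def orderSevenCertificates : List ((Fin 7 → ℤ) × (Fin 7 → Fin 7 → ℤ) × List ℤ) :=
  [ (![1, 1, 1, 1, 1, 1, 3],
      ![![0, 0, 0, 0, 0, 0, 3],
         ![0, 0, 0, 0, 0, 0, 3],
         ![0, 0, 0, 0, 0, 0, 3],
         ![0, 0, 0, 0, 0, 0, 3],
         ![0, 0, 0, 0, 0, 0, 3],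
         ![0, 0, 0, 0, 0, 0, 3],
         ![3, 3, 3, 3, 3, 3, 3]],
      [0, 18, -9]),
    (![4, 8, 3, 3, 3, 3, 12],
      ![![12, 6, 0, 0, 0, 0, -3],
         ![6, 3, 0, 0, 0, 0, 3],
         ![0, 0, 0, 0, 0, 0, 3],
         ![0, 0, 0, 0, 0, 0, 3],
         ![0, 0, 0, 0, 0, 0, 3],
         ![0, 0, 0, 0, 0, 0, 3],
         ![-3, 3, 3, 3, 3, 3, 3]],
      [0, 72, -36]),
    (![1, 1, 1, 1, 1, 1, 1],
      ![![2, 0, -4, 0, 0, 0, 2],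
         ![0, -2, 4, 0, 0, 0, 2],
         ![-4, 4, 0, 0, 0, 0, 1],
         ![0, 0, 0, 0, 0, 0, 3],
         ![0, 0, 0, 0, 0, 0, 3],
         ![0, 0, 0, 0, 0, 0, 3],
         ![2, 2, 1, 3, 3, 3, 0]],
      [0, 6, -6]),
    (![1, 1, 1, 3, 3, 3, 1],
      ![![0, 0, 0, -4, 0, 0, 1],
         ![0, 0, 0, -4, 0, 0, 1],
         ![0, 0, 0, -4, 0, 0, 1],
         ![-4, -4, -4, 0, 0, 0, -1],
         ![0, 0, 0, 0, 4, 0, 1],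
         ![0, 0, 0, 0, 0, 4, 1],
         ![1, 1, 1, -1, 1, 1, 1]],
      [0, -12, 13, 12]),
    (![1, 1, 1, 1, 1, 2, 2],
      ![![0, 0, 0, 0, 6, 0, 6],
         ![0, 0, 0, 0, 6, 0, 6],
         ![0, 0, 0, 0, 6, 0, 6],
         ![0, 0, 0, 0, 6, 0, 6],
         ![6, 6, 6, 6, -18, 0, 6],
         ![0, 0, 0, 0, 0, -3, 9],
         ![6, 6, 6, 6, 6, 9, 3]],
      [0, 30, -24]),
    (![1, 1, 1, 1, 1, 1, 2],
      ![![0, 0, 0, 0, 0, 2, 3],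
         ![0, 0, 0, 0, 0, 2, 3],
         ![0, 0, 0, 0, 0, 2, 3],
         ![0, 0, 0, 0, 0, 2, 3],
         ![0, 0, 0, 0, 0, 2, 3],
         ![2, 2, 2, 2, 2, 0, 1],
         ![3, 3, 3, 3, 3, 1, 3]],
      [0, 14, -8]),
    (![1, 1, 1, 3, 3, 3, 1],
      ![![4, 4, 4, 0, 0, 0, -1],
         ![4, 4, 4, 0, 0, 0, -1],
         ![4, 4, 4, 0, 0, 0, -1],
         ![0, 0, 0, 4, 0, 0, 1],
         ![0, 0, 0, 0, 4, 0, 1],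
         ![0, 0, 0, 0, 0, 4, -1],
         ![-1, -1, -1, 1, 1, -1, 1]],
      [0, 12, 13]),
    (![5, 5, 10, 15, 75, 75, 1],
      ![![1, 1, 0, 1, 0, 0, -2],
         ![1, 1, 0, 1, 0, 0, -4],
         ![0, 0, -1, -1, 0, 0, -3],
         ![1, 1, -1, 0, 0, 0, 2],
         ![0, 0, 0, 0, 0, 0, 1],
         ![0, 0, 0, 0, 0, 0, 1],
         ![-2, -4, -3, 2, 1, 1, 0]],
      [0, 20, -20]),
    (![2, 2, 3, 3, 2, 2, 1],
      ![![1, 1, 0, 0, 1, 0, 1],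
         ![1, 1, 0, 0, 1, 0, 1],
         ![0, 0, 0, 0, 1, 0, -1],
         ![0, 0, 0, 0, 1, 0, -1],
         ![1, 1, 1, 1, 0, 0, -1],
         ![0, 0, 0, 0, 0, -1, 2],
         ![1, 1, -1, -1, -1, 2, 2]],
      [0, -4, 6]),
    (![2, 4, 2, 1, 1, 1, 2],
      ![![-2, 2, 0, 0, 0, 2, 8],
         ![2, -2, 0, 0, 0, 4, -2],
         ![0, 0, 0, 0, 0, 6, 6],
         ![0, 0, 0, 0, 0, 6, 6],
         ![0, 0, 0, 0, 0, 6, 6],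
         ![2, 4, 6, 6, 6, -14, 4],
         ![8, -2, 6, 6, 6, 4, 4]],
      [0, 30, -24]),
    (![1, 4, 1, 2, 7, 7, 1],
      ![![1, 0, 2, 1, 0, 0, -2],
         ![0, 1, 1, -1, 0, 0, -1],
         ![2, 1, 5, 1, 0, 0, 2],
         ![1, -1, 1, 2, 0, 0, -1],
         ![0, 0, 0, 0, 0, 0, 1],
         ![0, 0, 0, 0, 0, 0, 1],
         ![-2, -1, 2, -1, 1, 1, 3]],
      [0, 7, -4]),
    (![1, 1, 2, 6, 2, 2, 1],
      ![![0, 0, 2, 0, 1, 0, 1],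
         ![0, 0, 2, 0, 1, 0, 1],
         ![2, 2, 0, 0, 1, 0, 1],
         ![0, 0, 0, 0, 1, 0, -1],
         ![1, 1, 1, 1, 0, 0, -1],
         ![0, 0, 0, 0, 0, -1, 2],
         ![1, 1, 1, -1, -1, 2, 2]],
      [0, -4, 6]),
    (![1, 1, 2, 2, 2, 1, 1],
      ![![4, 0, 2, 0, 0, -1, 3],
         ![0, 4, 2, 0, 0, 3, -1],
         ![2, 2, 2, 0, 0, 1, 1],
         ![0, 0, 0, 4, 0, 1, 1],
         ![0, 0, 0, 0, 4, 1, 1],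
         ![-1, 3, 1, 1, 1, 3, -1],
         ![3, -1, 1, 1, 1, -1, 3]],
      [0, 10, 8]),
    (![11, 1, 1, 1, 3, 1, 6],
      ![![0, 0, 0, 3, 3, 0, 2],
         ![0, 0, 0, 3, 3, 0, 2],
         ![0, 0, 0, 3, 3, 0, 2],
         ![3, 3, 3, 0, 3, 0, -4],
         ![3, 3, 3, 3, 6, 0, -2],
         ![0, 0, 0, 0, 0, 3, 5],
         ![2, 2, 2, -4, -2, 5, 3]],
      [0, 33, -27]),
    (![2, 1, 1, 2, 1, 1, 1],
      ![![0, 0, 0, 3, 0, 1, 1],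
         ![0, 0, 0, 3, 0, 1, 1],
         ![0, 0, 0, 3, 0, 1, 1],
         ![3, 3, 3, 3, 0, 2, 2],
         ![0, 0, 0, 0, -2, -2, 2],
         ![1, 1, 1, 2, -2, -1, 3],
         ![1, 1, 1, 2, 2, 3, -1]],
      [0, 14, -6]),
    (![1, 1, 1, 1, 1, 4, 1],
      ![![0, 0, 0, 0, 1, 2, 1],
         ![0, 0, 0, 0, 1, 2, 1],
         ![0, 0, 0, 0, 1, 2, 1],
         ![0, 0, 0, 0, 1, 2, 1],
         ![1, 1, 1, 1, 1, 1, 1],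
         ![2, 2, 2, 2, 1, 0, 1],
         ![1, 1, 1, 1, 1, 1, 1]],
      [0, 10, -8]),
    (![1, 1, 1, 1, 8, 4, 1],
      ![![4, 4, 4, 4, 0, 0, 1],
         ![4, 4, 4, 4, 0, 0, 1],
         ![4, 4, 4, 4, 0, 0, 1],
         ![4, 4, 4, 4, 0, 0, 1],
         ![0, 0, 0, 0, 2, 0, 1],
         ![0, 0, 0, 0, 0, 4, 1],
         ![1, 1, 1, 1, 1, 1, 1]],
      [0, 17, 16]),
    (![1, 1, 1, 2, 1, 3, 3],
      ![![6, 6, 6, 0, 9, 0, 3],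
         ![6, 6, 6, 0, 9, 0, 3],
         ![6, 6, 6, 0, 9, 0, 3],
         ![0, 0, 0, 18, 9, 0, -3],
         ![9, 9, 9, 9, 18, 0, 3],
         ![0, 0, 0, 0, 0, 9, 6],
         ![3, 3, 3, -3, 3, 6, 6]],
      [0, 45, 27]),
    (![8, 1, 1, 5, 1, 3, 1],
      ![![2, 2, 2, 0, 0, 1, 3],
         ![2, 2, 2, 0, 0, 1, 3],
         ![2, 2, 2, 0, 0, 1, 3],
         ![0, 0, 0, 4, 0, 1, 3],
         ![0, 0, 0, 0, 4, 5, -1],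
         ![1, 1, 1, 1, 5, 7, 1],
         ![3, 3, 3, 3, -1, 1, 7]],
      [0, 32, 20]),
    (![2, 2, 4, 3, 2, 13, 2],
      ![![3, 3, 0, 2, 4, 0, 1],
         ![3, 3, 0, 2, 4, 0, 1],
         ![0, 0, 6, 2, -2, 0, 1],
         ![2, 2, 2, 2, 2, 0, 1],
         ![4, 4, -2, 2, 6, 0, 1],
         ![0, 0, 0, 0, 0, 2, -1],
         ![1, 1, 1, 1, 1, -1, 1]],
      [0, 26, 28]),
    (![3, 1, 1, 1, 5, 1, 1],
      ![![1, 1, 0, -1, 0, 1, 1],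
         ![1, 1, 0, -1, 0, 1, 1],
         ![0, 0, 1, 2, 0, 1, 1],
         ![-1, -1, 2, 5, 0, 1, 1],
         ![0, 0, 0, 0, 1, -1, 1],
         ![1, 1, 1, 1, -1, 3, 1],
         ![1, 1, 1, 1, 1, 1, 3]],
      [0, 7]),
    (![5, 3, 11, 3, 5, 3, 8],
      ![![8, 8, 0, 0, -2, 6, 2],
         ![8, 8, 0, 0, -2, 6, 2],
         ![0, 0, 4, 0, 4, 4, -2],
         ![0, 0, 0, 8, 6, -2, 6],
         ![-2, -2, 4, 6, 9, 1, 2],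
         ![6, 6, 4, -2, 1, 9, -2],
         ![2, 2, -2, 6, 2, -2, 6]],
      [0, 84]),
    (![12, 12, 38, 12, 34, 12, 33],
      ![![0, 0, 2, 1, 1, 0, 3],
         ![0, 0, 2, 1, 1, 0, 3],
         ![2, 2, 4, 1, 5, 0, -3],
         ![1, 1, 1, 0, 2, 0, -3],
         ![1, 1, 5, 2, 4, 0, 3],
         ![0, 0, 0, 0, 0, 1, 5],
         ![3, 3, -3, -3, 3, 5, 7]],
      [0, 342, -153]),
    (![1, 6, 1, 1, 3, 1, 1],
      ![![5, 0, 5, -5, 0, 1, 2],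
         ![0, 1, 1, 2, 0, 1, 2],
         ![5, 1, 6, -3, 0, 2, 4],
         ![-5, 2, -3, 9, 0, 1, 2],
         ![0, 0, 0, 0, 5, -2, 1],
         ![1, 1, 2, 1, -2, 2, 2],
         ![2, 2, 4, 2, 1, 2, 5]],
      [0, 16]),
    (![1, 9, 5, 8, 1, 1, 1],
      ![![6, 0, 3, 0, 5, 5, 5],
         ![0, 2, -1, 0, 1, 3, -1],
         ![3, -1, 2, 0, 2, 1, 3],
         ![0, 0, 0, 3, -2, 1, 1],
         ![5, 1, 2, -2, 6, 5, 3],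
         ![5, 3, 1, 1, 5, 9, 3],
         ![5, -1, 3, 1, 3, 3, 5]],
      [0, 26]),
    (![1, 1, 1, 1, 1, 1, 1],
      ![![9, 0, 0, 1, 4, 3, 8],
         ![0, 9, 0, 2, -7, 6, 1],
         ![0, 0, 9, 7, 4, 3, -4],
         ![1, 2, 7, 6, 2, 4, -2],
         ![4, -7, 4, 2, 9, -2, 1],
         ![3, 6, 3, 4, -2, 6, 2],
         ![8, 1, -4, -2, 1, 2, 9]],
      [0, 19]),
    (![1, 1, 3, 4, 1, 1, 1],
      ![![5, 5, 0, 2, 4, 2, 2],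
         ![5, 5, 0, 2, 4, 2, 2],
         ![0, 0, 5, 1, -3, 1, 1],
         ![2, 2, 1, 1, 1, 1, 1],
         ![4, 4, -3, 1, 5, 1, 1],
         ![2, 2, 1, 1, 1, 1, 1],
         ![2, 2, 1, 1, 1, 1, 1]],
      [0, 18]),
    (![1, 1, 1, 6, 1, 1, 1],
      ![![1, 1, 1, 0, 2, 1, 1],
         ![1, 1, 1, 0, 2, 1, 1],
         ![1, 1, 1, 0, 2, 1, 1],
         ![0, 0, 0, 1, -1, 1, 1],
         ![2, 2, 2, -1, 5, 1, 1],
         ![1, 1, 1, 1, 1, 2, 2],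
         ![1, 1, 1, 1, 1, 2, 2]],
      [0, 9]),
    (![2, 2, 2, 2, 9, 2, 3],
      ![![5, 5, 5, 5, 0, 3, 2],
         ![5, 5, 5, 5, 0, 3, 2],
         ![5, 5, 5, 5, 0, 3, 2],
         ![5, 5, 5, 5, 0, 3, 2],
         ![0, 0, 0, 0, 5, -1, 1],
         ![3, 3, 3, 3, -1, 2, 1],
         ![2, 2, 2, 2, 1, 1, 1]],
      [0, 46]),
    (![1, 1, 1, 1, 1, 1, 2],
      ![![2, 2, 2, 2, 2, 0, 1],
         ![2, 2, 2, 2, 2, 0, 1],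
         ![2, 2, 2, 2, 2, 0, 1],
         ![2, 2, 2, 2, 2, 0, 1],
         ![2, 2, 2, 2, 2, 0, 1],
         ![0, 0, 0, 0, 0, 2, 3],
         ![1, 1, 1, 1, 1, 3, 5]],
      [0, 14, 8]),
    (![1, 1, 21, 4, 1, 1, 1],
      ![![5, 5, 1, 3, 3, 5, 3],
         ![5, 5, 1, 3, 3, 5, 3],
         ![1, 1, 1, -1, 1, 1, 1],
         ![3, 3, -1, 5, 1, 3, 1],
         ![3, 3, 1, 1, 2, 3, 2],
         ![5, 5, 1, 3, 3, 5, 3],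
         ![3, 3, 1, 1, 2, 3, 2]],
      [0, 30]),
    (![9, 2, 4, 2, 2, 2, 2],
      ![![6, 0, -2, 2, 2, 2, 2],
         ![0, 3, 5, 1, 4, 4, 1],
         ![-2, 5, 9, 1, 6, 6, 1],
         ![2, 1, 1, 1, 2, 2, 1],
         ![2, 4, 6, 2, 6, 6, 2],
         ![2, 4, 6, 2, 6, 6, 2],
         ![2, 1, 1, 1, 2, 2, 1]],
      [0, 62]) ]

theorem exists_isEigenvalueCertificate :
    ∀ r ∈ orderSevenTable, ∃ c ∈ orderSevenCertificates, IsEigenvalueCertificate r.1 r.2 c := by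
  decide +kernel

end Certificates

/-! ### Classification on seven vertices. -/

section OrderSeven

theorem minDistinctEigenvalues_le_of_mem_orderSevenTable {r : (Fin 7 → Fin 2) × ℕ}
    (hr : r ∈ orderSevenTable) : minDistinctEigenvalues (creationGraph r.1) ≤ r.2 :=
  let ⟨_, _, hc⟩ := exists_isEigenvalueCertificate r hr
  hc.minDistinctEigenvalues_le

theorem creationGraph_adj {n : ℕ} {b : Fin n → Fin 2} {i j : Fin n} :
    (creationGraph b).Adj i j ↔ i ≠ j ∧ b (max i j) = 1 :=
  Iff.rfl

instance {n : ℕ} (b : Fin n → Fin 2) : DecidableRel (creationGraph b).Adj :=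
  fun i j => inferInstanceAs (Decidable (i ≠ j ∧ b (max i j) = 1))

set_option synthInstance.maxSize 1000 in
set_option synthInstance.maxHeartbeats 200000 in
/-- The graphs of `orderSevenTable` with `q > 2` contain an independent set `S` as in
`three_le_minDistinctEigenvalues`. -/
theorem exists_crowded_independent_set :
    ∀ r ∈ orderSevenTable, r.2 = 2 ∨
      -- The first pair serves `b 5 = 0`, the second `b 3 = b 4 = 0` with `b 5 = 1`; the last two
      -- serve `(0,0,0,1,0,1,1)` and `(0,0,0,0,1,1,1)`.
      ∃ p ∈ ([({0, 5}, {6}), ({0, 3, 4}, {5, 6}), ({0, 1, 2, 4}, {3, 5, 6}),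
          ({0, 1, 2, 3}, {4, 5, 6})] : List (Finset (Fin 7) × Finset (Fin 7))),
        p.2.card < p.1.card ∧ (∀ i ∈ p.1, ∀ j ∈ p.1, ¬ (creationGraph r.1).Adj i j) ∧
        (∀ i ∈ p.1, ∀ j ∈ p.1, i ≠ j → ∀ k, (creationGraph r.1).Adj i k →
          (creationGraph r.1).Adj j k → k ∈ p.2) ∧
        ∀ i ∈ p.1, ∃ k ∈ p.2, (creationGraph r.1).Adj i k := by
  decide +kernel

theorem orderSevenTable_facts :
    ∀ r ∈ orderSevenTable, r.1 6 = 1 ∧ (r.2 = 2 ∨ r.2 = 3 ∨ r = (![0, 0, 0, 1, 0, 0, 1], 4)) := by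
  decide +kernel

theorem minDistinctEigenvalues_of_mem_orderSevenTable {r : (Fin 7 → Fin 2) × ℕ}
    (hr : r ∈ orderSevenTable) : minDistinctEigenvalues (creationGraph r.1) = r.2 := by
  refine le_antisymm (minDistinctEigenvalues_le_of_mem_orderSevenTable hr) ?_
  obtain ⟨h6, hq⟩ := orderSevenTable_facts r hr
  rcases hq with h2 | h3 | rfl
  · rw [h2]
    exact two_le_minDistinctEigenvalues (u := 0) (v := 6) ⟨by decide, h6⟩
  · rw [h3]
    rcases exists_crowded_independent_set r hr with h2 | ⟨p, -, hcard, hS, hT, hne⟩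
    · omega
    · exact three_le_minDistinctEigenvalues p.1 p.2 hcard hS hT hne
  · exact four_le_minDistinctEigenvalues

theorem creationGraph_connected {n : ℕ} {b : Fin (n + 1) → Fin 2} (h : b (Fin.last n) = 1) :
    (creationGraph b).Connected := by
  have hr (i : Fin (n + 1)) : (creationGraph b).Reachable i (Fin.last n) := by
    rcases eq_or_ne i (Fin.last n) with rfl | hi
    · exact SimpleGraph.Reachable.refl _
    · exact SimpleGraph.Adj.reachable ⟨hi, by rwa [max_eq_right (Fin.le_last i)]⟩
  exact ⟨fun i j => (hr i).trans (hr j).symm⟩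

/-- Two vertices are needed: a one-vertex graph is connected whatever its label. -/
theorem last_eq_one_of_connected {n : ℕ} {b : Fin (n + 2) → Fin 2}
    (h : (creationGraph b).Connected) : b (Fin.last (n + 1)) = 1 := by
  obtain ⟨j, hj⟩ := h.preconnected.exists_adj_of_nontrivial (Fin.last (n + 1))
  simpa [max_eq_left (Fin.le_last j)] using hj.2

/-- The larger of two distinct indices is never `0`, so one may normalise `b 0 = 0`. -/
theorem creationGraph_update_zero {n : ℕ} (b : Fin (n + 1) → Fin 2) (a : Fin 2) :
    creationGraph (Function.update b 0 a) = creationGraph b := by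
  ext i j
  simp only [creationGraph_adj]
  refine and_congr_right fun hij => ?_
  rw [Function.update_of_ne]
  intro h
  have hi : i ≤ 0 := h ▸ le_max_left i j
  have hj : j ≤ 0 := h ▸ le_max_right i j
  exact hij ((Fin.le_zero_iff.1 hi).trans (Fin.le_zero_iff.1 hj).symm)

theorem exists_mem_orderSevenTable_of_last :
    ∀ b : Fin 7 → Fin 2, b 0 = 0 → b 6 = 1 → ∃ r ∈ orderSevenTable, r.1 = b := by
  decide +kernel

theorem exists_mem_orderSevenTable {V : Type*} [Fintype V] {G : SimpleGraph V}
    (hcard : Fintype.card V = 7) (hconn : G.Connected) (hG : IsThresholdGraph G) :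
    ∃ r ∈ orderSevenTable, HasCreationSequence G r.1 := by
  unfold IsThresholdGraph at hG
  rw [hcard] at hG
  obtain ⟨b, ⟨e⟩⟩ := hG
  have h6 : b 6 = 1 := last_eq_one_of_connected (e.connected_iff.1 hconn)
  obtain ⟨r, hr, hrb⟩ := exists_mem_orderSevenTable_of_last (Function.update b 0 0) (by simp)
    (by rwa [Function.update_of_ne (by decide)])
  refine ⟨r, hr, ?_⟩
  rw [hrb, HasCreationSequence, creationGraph_update_zero]
  exact ⟨e⟩

/-- An encoding of the multiset of degrees. -/
def degreeCode {V : Type*} [Fintype V] (G : SimpleGraph V) [DecidableRel G.Adj] : ℕ :=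
  ∑ v, 10 ^ (Finset.univ.filter (G.Adj v)).card

theorem SimpleGraph.Iso.degreeCode_eq {V W : Type*} [Fintype V] [Fintype W] {G : SimpleGraph V}
    {H : SimpleGraph W} [DecidableRel G.Adj] [DecidableRel H.Adj] (e : G ≃g H) :
    degreeCode G = degreeCode H := by
  refine Fintype.sum_equiv e.toEquiv _ _ fun v => ?_
  congr 1
  exact Finset.card_equiv e.toEquiv fun w => by simpa using e.map_adj_iff.symm

/-- Threshold graphs are determined by their degrees. Base ten loses nothing, since each digit
counts at most seven vertices. -/
theorem nodup_degreeCode_orderSevenTable :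
    (orderSevenTable.map fun r => degreeCode (creationGraph r.1)).Nodup := by
  decide +kernel

end OrderSeven

/-- The table lists every connected threshold graph on seven vertices exactly once up to
isomorphism, its second column is the value of `q`, and exactly one graph has `q = 4`. -/
theorem mainTheorem11 :
    orderSevenTable.length = 32 ∧
    (∀ r ∈ orderSevenTable, (creationGraph r.1).Connected) ∧
    orderSevenTable.Pairwise
      (fun r s => IsEmpty (creationGraph r.1 ≃g creationGraph s.1)) ∧
    (∀ (V : Type u) [Fintype V] (G : SimpleGraph V), Fintype.card V = 7 →
      G.Connected → IsThresholdGraph G →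
        ∃ r ∈ orderSevenTable, HasCreationSequence G r.1) ∧
    (∀ r ∈ orderSevenTable, ∀ (V : Type u) [Fintype V] (G : SimpleGraph V),
      HasCreationSequence G r.1 → minDistinctEigenvalues G = r.2) ∧
    (∀ (V : Type u) [Fintype V] (G : SimpleGraph V), Fintype.card V = 7 →
      G.Connected → IsThresholdGraph G →
        (minDistinctEigenvalues G = 4 ↔ HasCreationSequence G ![0, 0, 0, 1, 0, 0, 1]) ∧
        (¬ HasCreationSequence G ![0, 0, 0, 1, 0, 0, 1] →
          minDistinctEigenvalues G = 2 ∨ minDistinctEigenvalues G = 3)) := by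
  have hq : ∀ r ∈ orderSevenTable, ∀ (V : Type u) [Fintype V] (G : SimpleGraph V),
      HasCreationSequence G r.1 → minDistinctEigenvalues G = r.2 := by
    rintro r hr V _ G ⟨e⟩
    rw [e.minDistinctEigenvalues_eq, minDistinctEigenvalues_of_mem_orderSevenTable hr]
  refine ⟨rfl, fun r hr => creationGraph_connected (orderSevenTable_facts r hr).1, ?_,
    fun V _ G => exists_mem_orderSevenTable, hq, fun V _ G hcard hconn hG => ?_⟩
  · have h := nodup_degreeCode_orderSevenTable
    rw [List.Nodup, List.pairwise_map] at h
    exact h.imp fun hne => ⟨fun e => hne e.degreeCode_eq⟩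
  · obtain ⟨r, hr, hGr⟩ := exists_mem_orderSevenTable hcard hconn hG
    have hmin := hq r hr V G hGr
    rcases (orderSevenTable_facts r hr).2 with h2 | h3 | h4
    · refine ⟨⟨fun h => by omega, fun h => ?_⟩, fun _ => Or.inl (hmin.trans h2)⟩
      exact hq (![0, 0, 0, 1, 0, 0, 1], 4) (by simp [orderSevenTable]) V G h
    · refine ⟨⟨fun h => by omega, fun h => ?_⟩, fun _ => Or.inr (hmin.trans h3)⟩
      exact hq (![0, 0, 0, 1, 0, 0, 1], 4) (by simp [orderSevenTable]) V G h
    · subst h4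
      exact ⟨⟨fun _ => hGr, fun _ => hmin⟩, fun h => absurd hGr h⟩
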